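/- Let $T>0$ and write $L^p=L^p(0,1)$; the index $\varepsilon$ runs over $(0,1]$. A net $(f_\varepsilon)$ in a normed space $X$ is called $X$-moderate if there are $N\in\mathbb N_0$ and $C$ with $\|f_\varepsilon\|_X\le C\varepsilon^{-N}$ for all $\varepsilon\in(0,1]$, and $X$-negligible if for every $k\in\mathbb N$ there is $C_k$ with $\|f_\varepsilon\|_X\le C_k\varepsilon^{k}$ for all $\varepsilon\in(0,1]$. A net $(f_\varepsilon)$ in $L^2$ whose distributional second derivatives $f_\varepsilon''$ belong to $L^2$ is called $H^2$-moderate, respectively $H^2$-negligible, if the same estimates hold for $\|f_\varepsilon\|_{L^2}+\|f_\varepsilon''\|_{L^2}$. For real-valued $q\in L^\infty$ let $\mathcal L_q=-\partial_x^2+q$ with Dirichlet boundary conditions on $(0,1)$. For real-valued $a,b,q\in L^\infty$ and complex-valued $u_0,u_1\in L^2$, a solution of $$\partial_t^2u+\mathcal L_{q}u+a(x)u+b(x)\partial_tu=0\ \text{ in }[0,T]\times(0,1),\qquad u(0,\cdot)=u_0,\quad \partial_tu(0,\cdot)=u_1,\qquad u(t,0)=u(t,1)=0 \qquad (P)$$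 is a function $u\in C([0,T];H^1_0(0,1))\cap C^1([0,T];L^2(0,1))$ that takes the initial values and satisfies the equation in the sense of distributions: for every $\varphi\in C_c^\infty(0,1)$ and $t\in[0,T]$, $$\frac{d}{dt}\int_0^1\partial_tu\,\varphi\,dx=-\int_0^1\big(\partial_xu\,\varphi'+q\,u\,\varphi+a\,u\,\varphi+b\,\partial_tu\,\varphi\big)dx .$$ Theorem (uniqueness of the very weak solution for $s=1$). Let $(a_\varepsilon),(\tilde a_\varepsilon),(b_\varepsilon),(\tilde b_\varepsilon)$ be $L^\infty$-moderate nets of non-negative functions and $(q_\varepsilon),(\tilde q_\varepsilon)$ be $L^\infty$-moderate nets of real-valued functions such that the operators $\mathcal L_{q_\varepsilon}$ are bounded below uniformly in $\varepsilon$, that is, there is $\Lambda\in\mathbb R$ with $$\int_0^1|f'|^2+q_\varepsilon|f|^2\,dx\ \ge\ -\Lambda\int_0^1|f|^2\,dx\qquad\text{for all } f\in H^1_0(0,1),\ \varepsilon\in(0,1]$$ (for instance $q_\varepsilon\ge0$ for all $\varepsilon$, or all Dirichlet eigenvalues of all $\mathcal L_{q_\varepsilon}$ positive). Let $(u_{0,\varepsilon}),(\tilde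 u_{0,\varepsilon})$ be $H^2$-moderate and $(u_{1,\varepsilon}),(\tilde u_{1,\varepsilon})$ be $L^2$-moderate. Suppose that $(a_\varepsilon-\tilde a_\varepsilon)$, $(b_\varepsilon-\tilde b_\varepsilon)$ and $(q_\varepsilon-\tilde q_\varepsilon)$ are $L^\infty$-negligible, that $(u_{0,\varepsilon}-\tilde u_{0,\varepsilon})$ is $H^2$-negligible and that $(u_{1,\varepsilon}-\tilde u_{1,\varepsilon})$ is $L^2$-negligible. Suppose that for every $\varepsilon\in(0,1]$ the function $u_\varepsilon$ is a solution of $(P)$ with the coefficients $a_\varepsilon,b_\varepsilon,q_\varepsilon$ and the data $u_{0,\varepsilon},u_{1,\varepsilon}$, and $\tilde u_\varepsilon$ is a solution of $(P)$ with $\tilde a_\varepsilon,\tilde b_\varepsilon,\tilde q_\varepsilon$ and $\tilde u_{0,\varepsilon},\tilde u_{1,\varepsilon}$. Then $(u_\varepsilon-\tilde u_\varepsilon)$ is $L^2$-negligible, uniformly in $t$: for every $k\in\mathbb N$ there is $C_k$ with $$\|u_\varepsilon(t,\cdot)-\tilde u_\varepsilon(t,\cdot)\|_{L^2}\le C_k\,\varepsilon^k\qquad\text{for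 all }\varepsilon\in(0,1],\ t\in[0,T].$$ In particular this holds when the nets are regularisations of distributions $a,b,q,u_0,u_1\in\mathcal D'(0,1)$, that is, the problem with these distributions as coefficients and data has a unique very weak solution. -/

import Mathlib

open MeasureTheory Set
open scoped ENNReal ContDiff

namespace VeryWeakWave

noncomputable section

/-- Lebesgue measure on the interval `(0,1)`. -/
abbrev mu : Measure ℝ := volume.restrict (Ioo (0 : ℝ) 1)

/-- The space `L²(0,1)` of complex-valued functions. -/
abbrev L2 : Type := Lp ℂ 2 mu

/-- The space `L^∞(0,1)` of real-valued functions; its order is the almost everywhere order. -/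
abbrev Linfty : Type := Lp ℝ ∞ mu

/-- Test functions: `φ ∈ C_c^∞((0,1))`. -/
structure IsTest (φ : ℝ → ℂ) : Prop where
  smooth : ContDiff ℝ ∞ φ
  compact : HasCompactSupport φ
  support : tsupport φ ⊆ Ioo (0 : ℝ) 1

/-- `f'' = h` on `(0,1)` in the sense of distributions. -/
def HasWeakSecondDeriv (f h : L2) : Prop :=
  ∀ φ : ℝ → ℂ, IsTest φ → ∫ x, f x * deriv (deriv φ) x ∂mu = ∫ x, h x * φ x ∂mu

/-- `f ∈ H¹₀(0,1)` with derivative `g ∈ L²(0,1)`: the function `f` has the absolutely continuous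
representative `x ↦ ∫_0^x g`, and this representative vanishes at `0` and at `1`. -/
structure HasH10Deriv (f g : L2) : Prop where
  ae_eq : ∀ᵐ x ∂mu, f x = ∫ y in (0 : ℝ)..x, g y
  boundary : ∫ y in (0 : ℝ)..1, g y = 0

/-- A net indexed by `ε ∈ (0,1]` in a normed space `X` is `X`-moderate. -/
def Moderate {X : Type*} [NormedAddCommGroup X] (f : ℝ → X) : Prop :=
  ∃ N : ℕ, ∃ C : ℝ, ∀ ε ∈ Ioc (0 : ℝ) 1, ‖f ε‖ ≤ C * (ε ^ N)⁻¹

/-- A net indexed by `ε ∈ (0,1]` in a normed space `X` is `X`-negligible. -/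
def Negligible {X : Type*} [NormedAddCommGroup X] (f : ℝ → X) : Prop :=
  ∀ k : ℕ, ∃ C : ℝ, ∀ ε ∈ Ioc (0 : ℝ) 1, ‖f ε‖ ≤ C * ε ^ k

/-- The net `f` is `H²`-moderate: `f_ε, f_ε'' ∈ L²` and `‖f_ε‖ + ‖f_ε''‖ ≤ C ε^{-N}`. -/
def H2Moderate (f : ℝ → L2) : Prop :=
  ∃ h : ℝ → L2, (∀ ε ∈ Ioc (0 : ℝ) 1, HasWeakSecondDeriv (f ε) (h ε)) ∧
    ∃ N : ℕ, ∃ C : ℝ, ∀ ε ∈ Ioc (0 : ℝ) 1, ‖f ε‖ + ‖h ε‖ ≤ C * (ε ^ N)⁻¹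

/-- The net `f` is `H²`-negligible: `f_ε, f_ε'' ∈ L²` and `‖f_ε‖ + ‖f_ε''‖ ≤ C_k ε^k` for all
`k`. -/
def H2Negligible (f : ℝ → L2) : Prop :=
  ∃ h : ℝ → L2, (∀ ε ∈ Ioc (0 : ℝ) 1, HasWeakSecondDeriv (f ε) (h ε)) ∧
    ∀ k : ℕ, ∃ C : ℝ, ∀ ε ∈ Ioc (0 : ℝ) 1, ‖f ε‖ + ‖h ε‖ ≤ C * ε ^ k

/-- The net `u` of functions of `t ∈ [0,T]` with values in `L²(0,1)` is `L²`-negligible, with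
constants that do not depend on `t`. -/
def L2NegligibleOn (T : ℝ) (u : ℝ → ℝ → L2) : Prop :=
  ∀ k : ℕ, ∃ C : ℝ, ∀ ε ∈ Ioc (0 : ℝ) 1, ∀ t ∈ Icc (0 : ℝ) T, ‖u ε t‖ ≤ C * ε ^ k

/-- The Sturm-Liouville operator `L_q = -d²/dx² + q` with Dirichlet boundary conditions is bounded
below by `-Λ`, that is `∫ |f'|² + q |f|² ≥ -Λ ∫ |f|²` on the form domain `H¹₀(0,1)`. -/
def SturmLiouvilleBoundedBelow (q : Linfty) (Λ : ℝ) : Prop :=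
  ∀ f g : L2, HasH10Deriv f g →
    -Λ * ∫ x, ‖f x‖ ^ 2 ∂mu ≤ (∫ x, ‖g x‖ ^ 2 ∂mu) + ∫ x, q x * ‖f x‖ ^ 2 ∂mu

/-- `u` is a solution on `[0,T] × (0,1)` of
`u_tt - u_xx + q u + a u + b u_t = 0`, `u(0) = u₀`, `u_t(0) = u₁`, `u(t,0) = u(t,1) = 0`,
in the class `C([0,T]; H¹₀(0,1)) ∩ C¹([0,T]; L²(0,1))`; the equation holds in the sense of
distributions on `(0,1)`, tested with functions of `x`. -/
def IsSolution (T : ℝ) (a b q : Linfty) (u₀ u₁ : L2) (u : ℝ → L2) : Prop :=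
  ∃ ut ux : ℝ → L2,
    (∀ t ∈ Icc (0 : ℝ) T, HasH10Deriv (u t) (ux t)) ∧
    ContinuousOn ux (Icc 0 T) ∧
    (∀ t ∈ Icc (0 : ℝ) T, HasDerivWithinAt u (ut t) (Icc 0 T) t) ∧
    ContinuousOn ut (Icc 0 T) ∧
    u 0 = u₀ ∧ ut 0 = u₁ ∧
    ∀ φ : ℝ → ℂ, IsTest φ → ∀ t ∈ Icc (0 : ℝ) T,
      HasDerivWithinAt (fun s => ∫ x, ut s x * φ x ∂mu)
        (-((∫ x, ux t x * deriv φ x ∂mu) + (∫ x, (q x : ℂ) * u t x * φ x ∂mu)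
          + (∫ x, (a x : ℂ) * u t x * φ x ∂mu) + ∫ x, (b x : ℂ) * ut t x * φ x ∂mu))
        (Icc 0 T) t

end

end VeryWeakWave

open VeryWeakWave

/-! The usual energy estimate pairs the equation with `∂ₜu`, which lies only in `L²`, so the pairing
is not available for solutions of this class. The proof integrates the equation in time instead.
With `U(t) = ∫₀ᵗ u` it becomes `∂ₜu - U_xx + (q + a) U + b u = u₁ + b u₀`
(`IsSolution.exists_integrated`), which may be tested with `u(t) ∈ H¹₀` itself. The energy `‖u‖² +
‖U_x‖² + ⟨U, (q + a) U⟩ + (Λ + 1)‖U‖²` then obeys a Gronwall inequality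
(`norm_le_of_integrated_equation`): the damping has a favourable sign, and the lower bound on the
operator makes the energy control `‖u‖² + ‖U‖²`.

The Gronwall rate depends only on the lower bound, not on `‖q_ε‖`, so its exponential is a constant
in `ε` rather than an exponential of `ε^{-N}`. The difference of two solutions satisfies the same
integrated equation, with a right-hand side in which each term contains a difference of coefficients
or data (`IsSolution.norm_sub_solution_le`). Each such term is negligible times moderate, hence
negligible. Only the `L²` norms of the data enter. -/

namespace VeryWeakWave

noncomputable section

open scoped InnerProductSpace ComplexConjugate

/-! ### Multiplication operators -/

/-- Multiplication of an `L²` function by an `L^∞` function, as a continuous bilinear map. -/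
def mulOp : Linfty →L[ℝ] L2 →L[ℝ] L2 :=
  (ContinuousLinearMap.lsmul ℝ ℝ : ℝ →L[ℝ] ℂ →L[ℝ] ℂ).holderL mu ∞ 2 2

theorem coeFn_mulOp (c : Linfty) (f : L2) : mulOp c f =ᵐ[mu] fun x => (c x : ℂ) * f x := by
  filter_upwards [(ContinuousLinearMap.lsmul ℝ ℝ : ℝ →L[ℝ] ℂ →L[ℝ] ℂ).coeFn_holder
    (r := 2) c f] with x hx
  simpa [mulOp] using hx

theorem norm_mulOp_apply_le (c : Linfty) (f : L2) : ‖mulOp c f‖ ≤ ‖c‖ * ‖f‖ := by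
  have h := (ContinuousLinearMap.lsmul ℝ ℝ : ℝ →L[ℝ] ℂ →L[ℝ] ℂ).norm_holder_apply_apply_le
    (r := 2) c f
  have h1 : ‖(ContinuousLinearMap.lsmul ℝ ℝ : ℝ →L[ℝ] ℂ →L[ℝ] ℂ)‖ ≤ 1 :=
    ContinuousLinearMap.opNorm_lsmul_le
  calc ‖mulOp c f‖ ≤ _ := h
    _ ≤ 1 * ‖c‖ * ‖f‖ := by gcongr
    _ = _ := by ring

theorem inner_mulOp_right (c : Linfty) (f g : L2) :
    ⟪f, mulOp c g⟫_ℂ = ∫ x, (c x : ℂ) * g x * conj (f x) ∂mu := by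
  rw [L2.inner_def]
  refine integral_congr_ae ?_
  filter_upwards [coeFn_mulOp c g] with x hx
  simp [hx]

theorem inner_mulOp_comm (c : Linfty) (f g : L2) : ⟪mulOp c f, g⟫_ℂ = ⟪f, mulOp c g⟫_ℂ := by
  rw [L2.inner_def, L2.inner_def]
  refine integral_congr_ae ?_
  filter_upwards [coeFn_mulOp c f, coeFn_mulOp c g] with x hx hy
  simp only [hx, hy, RCLike.inner_apply, map_mul, Complex.conj_ofReal]
  ring

theorem inner_mulOp_self (c : Linfty) (f : L2) :
    ⟪f, mulOp c f⟫_ℂ = ((∫ x, c x * ‖f x‖ ^ 2 ∂mu : ℝ) : ℂ) := by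
  rw [inner_mulOp_right, ← integral_complex_ofReal]
  refine integral_congr_ae (.of_forall fun x => ?_)
  simp only [mul_assoc, Complex.mul_conj, Complex.normSq_eq_norm_sq]
  push_cast; rfl

theorem re_inner_mulOp_self_nonneg {c : Linfty} (hc : 0 ≤ c) (f : L2) :
    0 ≤ (⟪f, mulOp c f⟫_ℂ).re := by
  rw [inner_mulOp_self, Complex.ofReal_re]
  refine integral_nonneg_of_ae ?_
  filter_upwards [(Lp.coeFn_nonneg c).2 hc] with x hx
  exact mul_nonneg hx (sq_nonneg _)

theorem L2_norm_sq (f : L2) : ‖f‖ ^ 2 = ∫ x, ‖f x‖ ^ 2 ∂mu := by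
  have h : ((‖f‖ ^ 2 : ℝ) : ℂ) = ((∫ x, ‖f x‖ ^ 2 ∂mu : ℝ) : ℂ) := by
    rw [← integral_complex_ofReal]
    have := inner_self_eq_norm_sq_to_K (𝕜 := ℂ) f
    rw [L2.inner_def] at this
    push_cast
    rw [← Complex.coe_algebraMap, ← RCLike.algebraMap_eq_ofReal] at *
    rw [← this]
    refine integral_congr_ae (.of_forall fun x => ?_)
    simp [inner_self_eq_norm_sq_to_K]
  exact_mod_cast h

/-! ### The primitive operator -/

theorem coeFn_L2_integrable (g : L2) : Integrable g mu :=
  (Lp.memLp g).integrable (by norm_num)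

theorem intervalIntegrable_coeFn (g : L2) {x y : ℝ} (hx : x ∈ Icc (0 : ℝ) 1)
    (hy : y ∈ Icc (0 : ℝ) 1) : IntervalIntegrable g volume x y := by
  have h : IntegrableOn g (Icc 0 1) := by
    rw [integrableOn_Icc_iff_integrableOn_Ioo]; exact coeFn_L2_integrable g
  exact (h.mono_set (uIcc_subset_Icc hx hy)).intervalIntegrable

theorem intervalIntegral_congr_mu {f g : ℝ → ℂ} (h : f =ᵐ[mu] g) {x : ℝ} (hx : x ∈ Icc (0 : ℝ) 1) :
    ∫ y in (0 : ℝ)..x, f y = ∫ y in (0 : ℝ)..x, g y := by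
  rw [intervalIntegral.integral_of_le hx.1, intervalIntegral.integral_of_le hx.1,
    integral_Ioc_eq_integral_Ioo, integral_Ioc_eq_integral_Ioo]
  exact integral_congr_ae (ae_restrict_of_ae_restrict_of_subset (Ioo_subset_Ioo_right hx.2) h)

theorem ae_mem_Icc : ∀ᵐ x ∂mu, x ∈ Icc (0 : ℝ) 1 := by
  filter_upwards [ae_restrict_mem measurableSet_Ioo] with x hx using Ioo_subset_Icc_self hx

instance : IsProbabilityMeasure mu := ⟨by simp [mu]⟩

theorem integral_norm_le_L2_norm (g : L2) : ∫ x, ‖g x‖ ∂mu ≤ ‖g‖ := by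
  have h := eLpNorm_le_eLpNorm_of_exponent_le (μ := mu) (p := 1) (q := 2) (by norm_num)
    (Lp.aestronglyMeasurable g)
  rw [← toReal_enorm, Lp.enorm_def, integral_norm_eq_lintegral_enorm (Lp.aestronglyMeasurable g),
    ← eLpNorm_one_eq_lintegral_enorm]
  exact ENNReal.toReal_mono (Lp.eLpNorm_ne_top g) h

theorem norm_primitive_le (g : L2) {x : ℝ} (hx : x ∈ Icc (0 : ℝ) 1) :
    ‖∫ y in (0 : ℝ)..x, g y‖ ≤ ‖g‖ := by
  refine le_trans ?_ (integral_norm_le_L2_norm g)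
  rw [intervalIntegral.integral_of_le hx.1, integral_Ioc_eq_integral_Ioo]
  refine (norm_integral_le_integral_norm _).trans ?_
  exact setIntegral_mono_set (coeFn_L2_integrable g).norm (.of_forall fun _ => norm_nonneg _)
    (Ioo_subset_Ioo_right hx.2).eventuallyLE

theorem memLp_primitive (g : L2) : MemLp (fun x => ∫ y in (0 : ℝ)..x, g y) 2 mu := by
  refine MemLp.of_bound ?_ ‖g‖ ?_
  · have h : IntegrableOn g (Icc 0 1) := by
      rw [integrableOn_Icc_iff_integrableOn_Ioo]; exact coeFn_L2_integrable g
    have := intervalIntegral.continuousOn_primitive_interval (μ := volume) (f := g) (a := 0)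
      (b := 1) (by simpa using h)
    rw [uIcc_of_le zero_le_one] at this
    exact (this.mono Ioo_subset_Icc_self).aestronglyMeasurable measurableSet_Ioo
  · filter_upwards [ae_mem_Icc] with x hx using norm_primitive_le g hx

/-- The operator `g ↦ (x ↦ ∫_0^x g)` on `L²(0,1)`. -/
def primitive : L2 →L[ℂ] L2 :=
  LinearMap.mkContinuous
    { toFun := fun g => (memLp_primitive g).toLp _
      map_add' := fun f g => by
        rw [← MemLp.toLp_add]
        refine MemLp.toLp_congr _ _ ?_
        filter_upwards [ae_mem_Icc] with x hx
        rw [intervalIntegral_congr_mu (Lp.coeFn_add f g) hx]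
        exact intervalIntegral.integral_add (intervalIntegrable_coeFn f (by simp) hx)
          (intervalIntegrable_coeFn g (by simp) hx)
      map_smul' := fun c g => by
        rw [← MemLp.toLp_const_smul]
        refine MemLp.toLp_congr _ _ ?_
        filter_upwards [ae_mem_Icc] with x hx
        rw [intervalIntegral_congr_mu (Lp.coeFn_smul c g) hx]
        exact intervalIntegral.integral_smul c g }
    1 fun g => by
      have h : ∀ᵐ x ∂mu, ‖(memLp_primitive g).toLp _ x‖ ≤ ‖g‖ := by
        filter_upwards [(memLp_primitive g).coeFn_toLp, ae_mem_Icc] with x h1 h2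
        rw [h1]; exact norm_primitive_le g h2
      -- The bound for bounded functions carries a power of the total mass, which is `1` here.
      have h1 : measureUnivNNReal mu = 1 := by simp [measureUnivNNReal]
      simpa [h1] using Lp.norm_le_of_ae_bound (norm_nonneg _) h

theorem coeFn_primitive (g : L2) : primitive g =ᵐ[mu] fun x => ∫ y in (0 : ℝ)..x, g y :=
  (memLp_primitive g).coeFn_toLp

/-- The constant function `1`. -/
def one : L2 := Lp.const 2 mu (1 : ℂ)

theorem inner_one (g : L2) : ⟪one, g⟫_ℂ = ∫ y in (0 : ℝ)..1, g y := by
  rw [L2.inner_def, intervalIntegral.integral_of_le zero_le_one, integral_Ioc_eq_integral_Ioo]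
  refine integral_congr_ae ?_
  filter_upwards [Lp.coeFn_const (p := 2) (μ := mu) (1 : ℂ)] with x hx
  simp [one]

/-- Recasts `H¹₀` as the image under `primitive` of the orthogonal complement of the constants. Both
conditions are linear and continuous in `g`, hence stable under differences and time integrals. -/
theorem hasH10Deriv_iff {f g : L2} : HasH10Deriv f g ↔ f = primitive g ∧ ⟪one, g⟫_ℂ = 0 := by
  rw [inner_one]
  constructor
  · rintro ⟨h1, h2⟩
    exact ⟨Lp.ext (Filter.EventuallyEq.trans h1 (coeFn_primitive g).symm), h2⟩
  · rintro ⟨rfl, h2⟩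
    exact ⟨coeFn_primitive g, h2⟩

theorem HasH10Deriv.sub {f g f' g' : L2} (h : HasH10Deriv f g) (h' : HasH10Deriv f' g') :
    HasH10Deriv (f - f') (g - g') := by
  rw [hasH10Deriv_iff] at *
  simp [h.1, h'.1, inner_sub_right, h.2, h'.2]

theorem hasH10Deriv_intervalIntegral {u ux : ℝ → L2} {T t : ℝ} (ht : t ∈ Icc (0 : ℝ) T)
    (h : ∀ s ∈ Icc (0 : ℝ) T, HasH10Deriv (u s) (ux s)) (hux : ContinuousOn ux (Icc 0 T)) :
    HasH10Deriv (∫ s in (0 : ℝ)..t, u s) (∫ s in (0 : ℝ)..t, ux s) := by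
  have hsub : uIcc 0 t ⊆ Icc 0 T := uIcc_subset_Icc ⟨le_rfl, ht.1.trans ht.2⟩ ht
  have hint : IntervalIntegrable ux volume 0 t := (hux.mono hsub).intervalIntegrable
  rw [hasH10Deriv_iff]
  constructor
  · rw [← ContinuousLinearMap.intervalIntegral_comp_comm _ hint]
    exact intervalIntegral.integral_congr fun s hs => (hasH10Deriv_iff.1 (h s (hsub hs))).1
  · rw [← innerSL_apply_apply ℂ, ← ContinuousLinearMap.intervalIntegral_comp_comm _ hint]
    refine (intervalIntegral.integral_congr (g := fun _ => (0 : ℂ)) fun s hs => ?_).trans (by simp)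
    simpa using (hasH10Deriv_iff.1 (h s (hsub hs))).2

/-! ### Test functions -/

theorem IsTest.conj {φ : ℝ → ℂ} (h : IsTest φ) : IsTest (fun x => conj (φ x)) where
  smooth := Complex.conjCLE.contDiff.comp h.smooth
  compact := h.compact.comp_left (g := fun z : ℂ => conj z) (map_zero _)
  support := (tsupport_comp_subset (g := fun z : ℂ => conj z) (map_zero _) φ).trans h.support

theorem IsTest.differentiable {φ : ℝ → ℂ} (h : IsTest φ) : Differentiable ℝ φ :=
  h.smooth.differentiable (by simp)

theorem IsTest.deriv {φ : ℝ → ℂ} (h : IsTest φ) : IsTest (deriv φ) where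
  smooth := (contDiff_infty_iff_deriv.1 h.smooth).2
  compact := h.compact.deriv
  support := (closure_minimal (support_deriv_subset) isClosed_closure).trans h.support

theorem IsTest.deriv_conj {φ : ℝ → ℂ} (h : IsTest φ) :
    _root_.deriv (fun x => conj (φ x)) = fun x => conj (_root_.deriv φ x) := by
  funext x
  exact (Complex.conjCLE.hasFDerivAt.comp_hasDerivAt x (h.differentiable x).hasDerivAt).deriv

theorem IsTest.eq_zero {φ : ℝ → ℂ} (h : IsTest φ) {x : ℝ} (hx : x ∉ Ioo (0 : ℝ) 1) : φ x = 0 :=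
  image_eq_zero_of_notMem_tsupport fun h' => hx (h.support h')

theorem IsTest.memLp {φ : ℝ → ℂ} (h : IsTest φ) : MemLp φ 2 mu :=
  h.smooth.continuous.memLp_of_hasCompactSupport h.compact

/-- The class in `L²(0,1)` of a test function. -/
def IsTest.toL2 {φ : ℝ → ℂ} (h : IsTest φ) : L2 := h.memLp.toLp φ

theorem IsTest.coeFn_toL2 {φ : ℝ → ℂ} (h : IsTest φ) : h.toL2 =ᵐ[mu] φ := h.memLp.coeFn_toLp

theorem IsTest.inner_toL2_left {φ : ℝ → ℂ} (h : IsTest φ) (f : L2) :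
    ⟪h.toL2, f⟫_ℂ = ∫ x, f x * conj (φ x) ∂mu := by
  rw [L2.inner_def]
  refine integral_congr_ae ?_
  filter_upwards [h.coeFn_toL2] with x hx
  simp [hx]

theorem IsTest.hasH10Deriv {φ : ℝ → ℂ} (h : IsTest φ) : HasH10Deriv h.toL2 h.deriv.toL2 := by
  have key : ∀ x ∈ Icc (0 : ℝ) 1, ∫ y in (0 : ℝ)..x, h.deriv.toL2 y = φ x := by
    intro x hx
    rw [intervalIntegral_congr_mu h.deriv.coeFn_toL2 hx,
      intervalIntegral.integral_deriv_eq_sub (fun y _ => h.differentiable y)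
        (h.deriv.smooth.continuous.intervalIntegrable _ _), h.eq_zero (x := 0) (by simp), sub_zero]
  refine ⟨?_, by rw [key 1 (by simp), h.eq_zero (by simp)]⟩
  filter_upwards [h.coeFn_toL2, ae_mem_Icc] with x h1 h2
  rw [key x h2]; exact h1

theorem IsTest.sub_smul {φ ψ : ℝ → ℂ} (h : IsTest φ) (h' : IsTest ψ) (c : ℂ) :
    IsTest (fun x => φ x - c * ψ x) where
  smooth := h.smooth.sub (contDiff_const.mul h'.smooth)
  compact := h.compact.sub (h'.compact.mul_left (f := fun _ => c))
  support := (tsupport_sub φ (fun x => c * ψ x)).trans (union_subset h.support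
    ((tsupport_mul_subset_right (f := fun _ => c)).trans h'.support))

/-- The primitive of a test function with mean zero is a test function. -/
theorem IsTest.primitive {φ : ℝ → ℂ} (h : IsTest φ) (hφ : ∫ y in (0 : ℝ)..1, φ y = 0) :
    IsTest (fun x => ∫ y in (0 : ℝ)..x, φ y) := by
  have hint : ∀ x y, IntervalIntegrable φ volume x y := h.smooth.continuous.intervalIntegrable
  have hd : ∀ x, HasDerivAt (fun x => ∫ y in (0 : ℝ)..x, φ y) (φ x) x := fun x =>
    h.smooth.continuous.integral_hasStrictDerivAt 0 x |>.hasDerivAt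
  -- The point `1 / 2` only keeps the set nonempty when `φ = 0`, so that its extreme points exist.
  have hK : IsCompact (tsupport φ ∪ {1 / 2}) := IsCompact.union h.compact isCompact_singleton
  have hKsub : tsupport φ ∪ {1 / 2} ⊆ Ioo (0 : ℝ) 1 :=
    union_subset h.support (singleton_subset_iff.2 (by norm_num))
  have hne : (tsupport φ ∪ {1 / 2}).Nonempty := ⟨1 / 2, by simp⟩
  obtain ⟨α, hα, hα'⟩ := hK.exists_isLeast hne
  obtain ⟨β, hβ, hβ'⟩ := hK.exists_isGreatest hne
  have h0 : ∀ y, y < α → φ y = 0 := fun y hy => image_eq_zero_of_notMem_tsupport fun h' =>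
    absurd (hα' (Or.inl h')) (not_le.2 hy)
  have h1 : ∀ y, β < y → φ y = 0 := fun y hy => image_eq_zero_of_notMem_tsupport fun h' =>
    absurd (hβ' (Or.inl h')) (not_le.2 hy)
  have hsupp : Function.support (fun x => ∫ y in (0 : ℝ)..x, φ y) ⊆ Icc α β := by
    intro x hx
    by_contra hx'
    apply hx
    rcases lt_or_ge x α with hlt | hge
    · refine (intervalIntegral.integral_congr (g := fun _ => (0 : ℂ)) fun y hy => ?_).trans
        (by simp)
      exact h0 y (hy.2.trans_lt (max_lt (hKsub hα).1 hlt))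
    · have hlt : β < x := not_le.1 fun h' => hx' ⟨hge, h'⟩
      -- To the right of the support the primitive equals the full mean, which is zero; since `β <
      -- 1`, this holds on both sides of `1`.
      have e : ∫ y in (1 : ℝ)..x, φ y = 0 :=
        (intervalIntegral.integral_congr (g := fun _ => (0 : ℂ)) fun y hy =>
          h1 y ((lt_min (hKsub hβ).2 hlt).trans_le hy.1)).trans (by simp)
      change ∫ y in (0 : ℝ)..x, φ y = 0
      rw [← intervalIntegral.integral_add_adjacent_intervals (hint 0 1) (hint 1 x), hφ, e, add_zero]
  have hts := closure_minimal hsupp isClosed_Icc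
  exact
    { smooth := contDiff_infty_iff_deriv.2 ⟨fun x => (hd x).differentiableAt, by
        rw [show _root_.deriv (fun x => ∫ y in (0 : ℝ)..x, φ y) = φ from
          funext fun x => (hd x).deriv]
        exact h.smooth⟩
      compact := isCompact_Icc.of_isClosed_subset isClosed_closure hts
      support := hts.trans (Icc_subset_Ioo (hKsub hα).1 (hKsub hβ).2) }

theorem exists_isTest_integral_eq_one : ∃ ρ : ℝ → ℂ, IsTest ρ ∧ ∫ y in (0 : ℝ)..1, ρ y = 1 := by
  let f : ContDiffBump (1 / 2 : ℝ) := ⟨1 / 8, 1 / 4, by norm_num, by norm_num⟩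
  have ht : tsupport (f.normed volume) ⊆ Ioo (0 : ℝ) 1 := by
    rw [f.tsupport_normed_eq, Real.closedBall_eq_Icc]
    exact Icc_subset_Ioo (by norm_num [f]) (by norm_num [f])
  refine ⟨fun x => (f.normed volume x : ℂ), ⟨?_, ?_, ?_⟩, ?_⟩
  · exact Complex.ofRealCLM.contDiff.comp f.contDiff_normed
  · exact f.hasCompactSupport_normed.comp_left (g := fun z : ℝ => (z : ℂ)) Complex.ofReal_zero
  · exact (tsupport_comp_subset (g := fun z : ℝ => (z : ℂ)) Complex.ofReal_zero _).trans ht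
  · rw [intervalIntegral.integral_ofReal, intervalIntegral.integral_eq_integral_of_support_subset,
      f.integral_normed, Complex.ofReal_one]
    exact (subset_tsupport _).trans (ht.trans Ioo_subset_Ioc_self)

/-- An element of `L²(0,1)` orthogonal to all test functions vanishes. -/
theorem eq_zero_of_forall_inner_isTest {s : L2}
    (h : ∀ (φ : ℝ → ℂ) (hφ : IsTest φ), ⟪hφ.toL2, s⟫_ℂ = 0) : s = 0 := by
  have hs : LocallyIntegrableOn s (Ioo (0 : ℝ) 1) volume :=
    IntegrableOn.locallyIntegrableOn (coeFn_L2_integrable s)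
  have := isOpen_Ioo.ae_eq_zero_of_integral_contDiff_smul_eq_zero hs fun g hg1 hg2 hg3 => by
    have hT : IsTest (fun x => (g x : ℂ)) :=
      ⟨Complex.ofRealCLM.contDiff.comp hg1,
        hg2.comp_left (g := fun z : ℝ => (z : ℂ)) Complex.ofReal_zero,
        (tsupport_comp_subset (g := fun z : ℝ => (z : ℂ)) Complex.ofReal_zero _).trans hg3⟩
    have h0 := h _ hT
    rw [hT.inner_toL2_left] at h0
    rw [← setIntegral_eq_integral_of_forall_compl_eq_zero (s := Ioo (0 : ℝ) 1), ← h0]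
    · refine integral_congr_ae (.of_forall fun x => ?_)
      simp [mul_comm]
    · intro x hx
      rw [image_eq_zero_of_notMem_tsupport fun h' => hx (hg3 h'), zero_smul]
  refine (Lp.eq_zero_iff_ae_eq_zero).2 ?_
  exact (ae_restrict_iff' measurableSet_Ioo).2 this

/-- Lemma of du Bois-Reymond. -/
theorem exists_eq_smul_one_of_forall_inner_deriv {s : L2}
    (h : ∀ (φ : ℝ → ℂ) (hφ : IsTest φ), ⟪hφ.deriv.toL2, s⟫_ℂ = 0) : ∃ c : ℂ, s = c • one := by
  obtain ⟨ρ, hρ, hρ1⟩ := exists_isTest_integral_eq_one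
  -- For a test function `φ` with integral `m`, the function `φ - m ρ` has mean zero and so is the
  -- derivative of a test function. Hence `⟨φ, s⟩ = conj m * ⟨ρ, s⟩`, which identifies the constant.
  refine ⟨⟪hρ.toL2, s⟫_ℂ, sub_eq_zero.1 (eq_zero_of_forall_inner_isTest fun φ hφ => ?_)⟩
  set m := ∫ y in (0 : ℝ)..1, φ y with hm
  have hψ := hφ.sub_smul hρ m
  have h0 : ∫ y in (0 : ℝ)..1, (φ y - m * ρ y) = 0 := by
    rw [intervalIntegral.integral_sub (hφ.smooth.continuous.intervalIntegrable _ _)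
      ((hρ.smooth.continuous.intervalIntegrable _ _).const_mul m),
      intervalIntegral.integral_const_mul, hρ1, ← hm]
    ring
  have hd : deriv (fun x => ∫ y in (0 : ℝ)..x, (φ y - m * ρ y)) = fun x => φ x - m * ρ x :=
    funext fun x => (hψ.smooth.continuous.integral_hasStrictDerivAt 0 x).hasDerivAt.deriv
  have e1 : (hψ.primitive h0).deriv.toL2 = hφ.toL2 - m • hρ.toL2 := by
    rw [IsTest.toL2, IsTest.toL2, IsTest.toL2, ← MemLp.toLp_const_smul, ← MemLp.toLp_sub]
    refine MemLp.toLp_congr _ _ (.of_forall fun x => ?_)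
    rw [hd]; simp
  have e2 : ⟪one, hφ.toL2⟫_ℂ = m := by
    rw [inner_one, intervalIntegral_congr_mu hφ.coeFn_toL2 (by simp)]
  have e3 : ⟪hφ.toL2, one⟫_ℂ = conj m := by rw [← e2, inner_conj_symm]
  have := h _ (hψ.primitive h0)
  rw [e1, inner_sub_left, inner_smul_left] at this
  rw [inner_sub_right, inner_smul_right, e3, mul_comm]
  exact this

/-- A weak identity tested with test functions extends to `H¹₀(0,1)`. -/
theorem inner_add_inner_eq_zero_of_isTest {p r : L2}
    (h : ∀ (φ : ℝ → ℂ) (hφ : IsTest φ), ⟪hφ.toL2, p⟫_ℂ + ⟪hφ.deriv.toL2, r⟫_ℂ = 0)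
    {f g : L2} (hfg : HasH10Deriv f g) : ⟪f, p⟫_ℂ + ⟪g, r⟫_ℂ = 0 := by
  -- Substituting `f = primitive g` turns the identity into orthogonality of `g` to one fixed
  -- element. By du Bois-Reymond that element is constant, and derivatives of `H¹₀` functions are
  -- orthogonal to constants. No density argument is needed.
  have key : ∀ f g : L2, HasH10Deriv f g →
      ⟪g, ContinuousLinearMap.adjoint primitive p + r⟫_ℂ = ⟪f, p⟫_ℂ + ⟪g, r⟫_ℂ := by
    intro f g hfg
    rw [inner_add_right, ContinuousLinearMap.adjoint_inner_right, ← (hasH10Deriv_iff.1 hfg).1]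
  obtain ⟨c, hc⟩ := exists_eq_smul_one_of_forall_inner_deriv
    (s := ContinuousLinearMap.adjoint primitive p + r)
    fun φ hφ => by rw [key _ _ hφ.hasH10Deriv]; exact h φ hφ
  rw [← key f g hfg, hc, inner_smul_right, ← inner_conj_symm, (hasH10Deriv_iff.1 hfg).2]
  simp

/-! ### The energy estimate -/

theorem hasDerivWithinAt_intervalIntegral_Icc {E : Type*} [NormedAddCommGroup E] [NormedSpace ℝ E]
    [CompleteSpace E] {u : ℝ → E} {T t : ℝ} (hu : ContinuousOn u (Icc 0 T))
    (ht : t ∈ Icc (0 : ℝ) T) :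
    HasDerivWithinAt (fun s => ∫ r in (0 : ℝ)..s, u r) (u t) (Icc 0 T) t := by
  have := Fact.mk ht
  have hsub : uIcc 0 t ⊆ Icc 0 T := uIcc_subset_Icc ⟨le_rfl, ht.1.trans ht.2⟩ ht
  exact intervalIntegral.integral_hasDerivWithinAt_right (hu.mono hsub).intervalIntegrable
    (hu.stronglyMeasurableAtFilter_nhdsWithin measurableSet_Icc t) (hu t ht)

/-- Gronwall's inequality: `exp (-K t) * E t` has nonpositive derivative. -/
theorem le_exp_mul_of_deriv_le {E E' : ℝ → ℝ} {K T : ℝ}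
    (hE : ∀ t ∈ Icc (0 : ℝ) T, HasDerivWithinAt E (E' t) (Icc 0 T) t)
    (hE' : ∀ t ∈ Icc (0 : ℝ) T, E' t ≤ K * E t) :
    ∀ t ∈ Icc (0 : ℝ) T, E t ≤ Real.exp (K * t) * E 0 := by
  have hd : ∀ t ∈ Icc (0 : ℝ) T, HasDerivWithinAt (fun t => Real.exp (-K * t) * E t)
      (Real.exp (-K * t) * (E' t - K * E t)) (Icc 0 T) t := by
    intro t ht
    have h1 : HasDerivAt (fun t => Real.exp (-K * t)) (Real.exp (-K * t) * (-K * 1)) t :=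
      ((hasDerivAt_id t).const_mul (-K)).exp
    exact (h1.hasDerivWithinAt.mul (hE t ht)).congr_deriv (by ring)
  have hanti : AntitoneOn (fun t => Real.exp (-K * t) * E t) (Icc 0 T) :=
    antitoneOn_of_hasDerivWithinAt_nonpos (convex_Icc 0 T)
      (fun t ht => (hd t ht).continuousWithinAt)
      (fun t ht => (hd t (interior_subset ht)).mono interior_subset)
      (fun t ht => mul_nonpos_of_nonneg_of_nonpos (Real.exp_pos _).le
        (sub_nonpos.2 (hE' t (interior_subset ht))))
  intro t ht
  have h := hanti ⟨le_rfl, ht.1.trans ht.2⟩ ht ht.1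
  simp only [mul_zero, Real.exp_zero, one_mul] at h
  calc E t = Real.exp (K * t) * (Real.exp (-K * t) * E t) := by
        rw [← mul_assoc, ← Real.exp_add]; simp
    _ ≤ _ := by gcongr

/-- `L²`-estimate for the weak solutions of the wave equation integrated in time. -/
theorem norm_le_of_integrated_equation {T Λ D : ℝ} (hΛ : 0 ≤ Λ) {b c : Linfty} (hb : 0 ≤ b)
    (hc : ∀ f g : L2, HasH10Deriv f g → -Λ * ‖f‖ ^ 2 ≤ ‖g‖ ^ 2 + (⟪f, mulOp c f⟫_ℂ).re)
    {u ut ux H : ℝ → L2} (hux : ∀ t ∈ Icc (0 : ℝ) T, HasH10Deriv (u t) (ux t))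
    (hux_cont : ContinuousOn ux (Icc 0 T))
    (hut : ∀ t ∈ Icc (0 : ℝ) T, HasDerivWithinAt u (ut t) (Icc 0 T) t)
    (hH : ∀ t ∈ Icc (0 : ℝ) T, ‖H t‖ ≤ D)
    (heq : ∀ t ∈ Icc (0 : ℝ) T, ∀ f g : L2, HasH10Deriv f g →
      ⟪f, ut t + mulOp c (∫ s in (0 : ℝ)..t, u s) + mulOp b (u t) - H t⟫_ℂ
        + ⟪g, ∫ s in (0 : ℝ)..t, ux s⟫_ℂ = 0) :
    ∀ t ∈ Icc (0 : ℝ) T, ‖u t‖ ≤ Real.exp ((Λ + 2) * T) * (‖u 0‖ + D) := by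
  have hu_cont : ContinuousOn u (Icc 0 T) := fun t ht => (hut t ht).continuousWithinAt
  set U : ℝ → L2 := fun t => ∫ s in (0 : ℝ)..t, u s
  set Ux : ℝ → L2 := fun t => ∫ s in (0 : ℝ)..t, ux s
  have hU : ∀ t ∈ Icc (0 : ℝ) T, HasDerivWithinAt U (u t) (Icc 0 T) t := fun t ht =>
    hasDerivWithinAt_intervalIntegral_Icc hu_cont ht
  have hUx : ∀ t ∈ Icc (0 : ℝ) T, HasDerivWithinAt Ux (ux t) (Icc 0 T) t := fun t ht =>
    hasDerivWithinAt_intervalIntegral_Icc hux_cont ht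
  have hcU : ∀ t ∈ Icc (0 : ℝ) T,
      HasDerivWithinAt (fun s => mulOp c (U s)) (mulOp c (u t)) (Icc 0 T) t := fun t ht =>
    (mulOp c).hasFDerivAt.comp_hasDerivWithinAt t (hU t ht)
  have hre : ∀ {f g : ℝ → L2} {f' g' : L2} {t : ℝ}, HasDerivWithinAt f f' (Icc 0 T) t →
      HasDerivWithinAt g g' (Icc 0 T) t → HasDerivWithinAt (fun s => (⟪f s, g s⟫_ℂ).re)
        ((⟪f t, g'⟫_ℂ).re + (⟪f', g t⟫_ℂ).re) (Icc 0 T) t := by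
    intro f g f' g' t hf hg
    have := Complex.reCLM.hasFDerivAt.comp_hasDerivWithinAt t (hf.inner ℂ hg)
    exact this.congr_deriv (by simp)
  have hsymm : ∀ f g : L2, (⟪f, g⟫_ℂ).re = (⟪g, f⟫_ℂ).re := fun f g => inner_re_symm (𝕜 := ℂ) f g
  have hself : ∀ f : L2, (⟪f, f⟫_ℂ).re = ‖f‖ ^ 2 := fun f => inner_self_eq_norm_sq (𝕜 := ℂ) f
  have hcs : ∀ f g : L2, 2 * (⟪f, g⟫_ℂ).re ≤ ‖f‖ ^ 2 + ‖g‖ ^ 2 := by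
    intro f g
    have h1 : (⟪f, g⟫_ℂ).re ≤ ‖f‖ * ‖g‖ := re_inner_le_norm (𝕜 := ℂ) f g
    nlinarith [sq_nonneg (‖f‖ - ‖g‖)]
  -- Of the weight `Λ + 1`, the part `Λ` compensates the negative part of the form and the `1`
  -- leaves control of `‖U‖²`. The constant `D ^ 2` lets the source term be absorbed into `E`,
  -- making the differential inequality homogeneous.
  set E : ℝ → ℝ := fun t => ((⟪u t, u t⟫_ℂ).re + (⟪Ux t, Ux t⟫_ℂ).re
    + (⟪U t, mulOp c (U t)⟫_ℂ).re + (Λ + 1) * (⟪U t, U t⟫_ℂ).re) + D ^ 2 with hE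
  have hE_ge : ∀ t ∈ Icc (0 : ℝ) T, ‖u t‖ ^ 2 + ‖U t‖ ^ 2 + D ^ 2 ≤ E t := by
    intro t ht
    have := hc _ _ (hasH10Deriv_intervalIntegral ht hux hux_cont)
    simp only [hE, hself]
    linarith
  have hEd := fun t (ht : t ∈ Icc (0 : ℝ) T) =>
    ((((hre (hut t ht) (hut t ht)).add (hre (hUx t ht) (hUx t ht))).add
      (hre (hU t ht) (hcU t ht))).add ((hre (hU t ht) (hU t ht)).const_mul (Λ + 1))).add_const
        (D ^ 2)
  have hE0 : E 0 = ‖u 0‖ ^ 2 + D ^ 2 := by simp only [hE, hself]; simp [U, Ux]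
  have hgron := le_exp_mul_of_deriv_le (E := E) (K := Λ + 2) hEd fun t ht => by
    -- The test function is `u t` itself; twice this identity removes `ut`, `Ux` and `c` from the
    -- derivative of `E`.
    have h0 := congrArg Complex.re (heq t ht _ _ (hux t ht))
    simp only [inner_add_right, inner_sub_right, Complex.add_re, Complex.sub_re,
      Complex.zero_re] at h0
    have h1 := re_inner_mulOp_self_nonneg hb (u t)
    have h2 := hcs (u t) (H t)
    have h3 := hcs (u t) (U t)
    have h4 : ‖H t‖ ^ 2 ≤ D ^ 2 := pow_le_pow_left₀ (norm_nonneg _) (hH t ht) 2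
    have h5 := hE_ge t ht
    rw [hsymm (ut t) (u t), hsymm (Ux t) (ux t), ← inner_mulOp_comm c (U t) (u t),
      hsymm (mulOp c (U t)) (u t), hsymm (U t) (u t)]
    have h6 : (Λ + 1) * (2 * (⟪u t, U t⟫_ℂ).re) ≤ (Λ + 1) * (‖u t‖ ^ 2 + ‖U t‖ ^ 2) := by gcongr
    have h7 : (Λ + 2) * (‖u t‖ ^ 2 + ‖U t‖ ^ 2 + D ^ 2) ≤ (Λ + 2) * E t := by gcongr
    have h8 : 0 ≤ (Λ + 1) * D ^ 2 := by positivity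
    -- What remains is `2 Re⟨u, H⟩ - 2 Re⟨u, b u⟩ + 2(Λ + 1) Re⟨u, U⟩`, at most `‖u‖² + D² + (Λ +
    -- 1)(‖u‖² + ‖U‖²)`. This falls short of `(Λ + 2)(‖u‖² + ‖U‖² + D²)` by `‖U‖² + (Λ + 1) D²`.
    nlinarith [sq_nonneg ‖U t‖]
  intro t ht
  have hT : 0 ≤ T := ht.1.trans ht.2
  have hD : 0 ≤ D := (norm_nonneg _).trans (hH t ht)
  have hexp : Real.exp ((Λ + 2) * t) ≤ Real.exp ((Λ + 2) * T) := by
    have := ht.2; gcongr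
  have hone : 1 ≤ Real.exp ((Λ + 2) * T) := Real.one_le_exp (by positivity)
  refine le_of_sq_le_sq ?_ (by positivity)
  calc ‖u t‖ ^ 2 ≤ E t := by nlinarith [hE_ge t ht, sq_nonneg ‖U t‖, sq_nonneg D]
    _ ≤ Real.exp ((Λ + 2) * t) * E 0 := hgron t ht
    _ ≤ Real.exp ((Λ + 2) * T) * (‖u 0‖ + D) ^ 2 := by
        rw [hE0]
        gcongr
        nlinarith [mul_nonneg (norm_nonneg (u 0)) hD]
    -- The exponential is at least `1`, so squaring it loses nothing essential and makes the right
    -- side a perfect square.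
    _ ≤ Real.exp ((Λ + 2) * T) ^ 2 * (‖u 0‖ + D) ^ 2 := by
        gcongr
        exact le_self_pow₀ hone two_ne_zero
    _ = _ := by ring

/-! ### Solutions -/

/-- The equation of `IsSolution`, integrated in time and tested with `H¹₀(0,1)`. -/
theorem IsSolution.exists_integrated {T : ℝ} {a b q : Linfty} {u₀ u₁ : L2} {u : ℝ → L2}
    (h : IsSolution T a b q u₀ u₁ u) : ∃ ut ux : ℝ → L2,
      (∀ t ∈ Icc (0 : ℝ) T, HasH10Deriv (u t) (ux t)) ∧
      ContinuousOn ux (Icc 0 T) ∧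
      (∀ t ∈ Icc (0 : ℝ) T, HasDerivWithinAt u (ut t) (Icc 0 T) t) ∧ u 0 = u₀ ∧
      ∀ t ∈ Icc (0 : ℝ) T, ∀ f g : L2, HasH10Deriv f g →
        ⟪f, ut t + mulOp (q + a) (∫ s in (0 : ℝ)..t, u s) + mulOp b (u t)
          - (u₁ + mulOp b u₀)⟫_ℂ + ⟪g, ∫ s in (0 : ℝ)..t, ux s⟫_ℂ = 0 := by
  obtain ⟨ut, ux, hux, hux_cont, hut, -, h0, h1, hw⟩ := h
  refine ⟨ut, ux, hux, hux_cont, hut, h0, fun t ht f g hfg =>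
    inner_add_inner_eq_zero_of_isTest (fun φ hφ => ?_) hfg⟩
  have hu_cont : ContinuousOn u (Icc 0 T) := fun t ht => (hut t ht).continuousWithinAt
  have hlin : ∀ (p : L2) {v : ℝ → L2} {v' : L2} {t : ℝ}, HasDerivWithinAt v v' (Icc 0 T) t →
      HasDerivWithinAt (fun s => ⟪p, v s⟫_ℂ) ⟪p, v'⟫_ℂ (Icc 0 T) t := fun p v v' t hv =>
    ((innerSL ℂ p).restrictScalars ℝ).hasFDerivAt.comp_hasDerivWithinAt t hv
  have hmul : ∀ (c : Linfty) (v : L2),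
      ∫ x, (c x : ℂ) * v x * conj (φ x) ∂mu = ⟪hφ.toL2, mulOp c v⟫_ℂ := by
    intro c v
    rw [hφ.inner_toL2_left]
    refine integral_congr_ae ?_
    filter_upwards [coeFn_mulOp c v] with x hx
    rw [hx]
  have hd : ∀ s ∈ Icc (0 : ℝ) T, HasDerivWithinAt (fun s => ⟪hφ.toL2, ut s⟫_ℂ
      + ⟪hφ.toL2, mulOp (q + a) (∫ r in (0 : ℝ)..s, u r)⟫_ℂ + ⟪hφ.toL2, mulOp b (u s)⟫_ℂ
      + ⟪hφ.deriv.toL2, ∫ r in (0 : ℝ)..s, ux r⟫_ℂ) 0 (Icc 0 T) s := by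
    intro s hs
    -- The weak equation is bilinear whereas the inner product is conjugate linear on the left, so
    -- the conjugate of `φ` is inserted.
    have e1 := hw _ hφ.conj s hs
    simp only [hmul, hφ.deriv_conj, ← hφ.inner_toL2_left, ← hφ.deriv.inner_toL2_left] at e1
    have e2 := hlin hφ.toL2 ((mulOp (q + a)).hasFDerivAt.comp_hasDerivWithinAt s
      (hasDerivWithinAt_intervalIntegral_Icc hu_cont hs))
    have e3 := hlin hφ.toL2 ((mulOp b).hasFDerivAt.comp_hasDerivWithinAt s (hut s hs))
    have e4 := hlin hφ.deriv.toL2 (hasDerivWithinAt_intervalIntegral_Icc hux_cont hs)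
    refine (((e1.add e2).add e3).add e4).congr_deriv ?_
    simp only [map_add, add_apply, inner_add_right]
    ring
  -- The integrated quantity is constant in time, and its value at `0` is `⟨φ, u₁ + b u₀⟩`.
  have hconst := constant_of_has_deriv_right_zero (fun s hs => (hd s hs).continuousWithinAt)
    (fun s hs => (hd s (Ico_subset_Icc_self hs)).mono_of_mem_nhdsWithin
      (Icc_mem_nhdsGE_of_mem hs)) t ht
  simp only [intervalIntegral.integral_same, map_zero, inner_zero_right, add_zero, h0, h1]
    at hconst
  rw [inner_sub_right, inner_add_right, inner_add_right, inner_add_right, ← hconst]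
  ring

theorem sturmLiouvilleBoundedBelow_iff {q : Linfty} {Λ : ℝ} : SturmLiouvilleBoundedBelow q Λ ↔
    ∀ f g : L2, HasH10Deriv f g → -Λ * ‖f‖ ^ 2 ≤ ‖g‖ ^ 2 + (⟪f, mulOp q f⟫_ℂ).re := by
  simp only [SturmLiouvilleBoundedBelow, inner_mulOp_self, Complex.ofReal_re, L2_norm_sq]

theorem SturmLiouvilleBoundedBelow.add_nonneg {q a : Linfty} {Λ : ℝ}
    (h : SturmLiouvilleBoundedBelow q Λ) (ha : 0 ≤ a) : SturmLiouvilleBoundedBelow (q + a) Λ := by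
  rw [sturmLiouvilleBoundedBelow_iff] at *
  intro f g hfg
  have h1 := h f g hfg
  have h2 := re_inner_mulOp_self_nonneg ha f
  simp only [map_add, add_apply, inner_add_right, Complex.add_re]
  linarith

theorem SturmLiouvilleBoundedBelow.mono {q : Linfty} {Λ Λ' : ℝ}
    (h : SturmLiouvilleBoundedBelow q Λ) (hΛ : Λ ≤ Λ') : SturmLiouvilleBoundedBelow q Λ' := by
  rw [sturmLiouvilleBoundedBelow_iff] at *
  intro f g hfg
  refine le_trans ?_ (h f g hfg)
  gcongr

/-- A bounded perturbation of the potential moves the quadratic form by at most `C ‖f‖²`. This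
transfers the lower bound from `q_ε` to the second net, for which none is assumed. -/
theorem SturmLiouvilleBoundedBelow.of_norm_sub_le {q q' : Linfty} {Λ C : ℝ}
    (h : SturmLiouvilleBoundedBelow q Λ) (hC : ‖q - q'‖ ≤ C) :
    SturmLiouvilleBoundedBelow q' (Λ + C) := by
  rw [sturmLiouvilleBoundedBelow_iff] at *
  intro f g hfg
  have h1 := h f g hfg
  have h2 : (⟪f, mulOp (q - q') f⟫_ℂ).re ≤ C * ‖f‖ ^ 2 :=
    calc _ ≤ ‖f‖ * ‖mulOp (q - q') f‖ := re_inner_le_norm (𝕜 := ℂ) _ _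
      _ ≤ ‖f‖ * (C * ‖f‖) := by
        gcongr
        exact (norm_mulOp_apply_le _ _).trans (by gcongr)
      _ = _ := by ring
  simp only [map_sub, sub_apply, inner_sub_right, Complex.sub_re] at h2
  linarith

/-- A priori bound from the energy estimate with the time-independent source `u₁ + b u₀`; it makes
the second solution net moderate, uniformly in `t`. -/
theorem IsSolution.norm_le {T Λ : ℝ} {a b q : Linfty} {u₀ u₁ : L2} {u : ℝ → L2}
    (h : IsSolution T a b q u₀ u₁ u) (hΛ : 0 ≤ Λ) (ha : 0 ≤ a) (hb : 0 ≤ b)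
    (hq : SturmLiouvilleBoundedBelow q Λ) : ∀ t ∈ Icc (0 : ℝ) T,
      ‖u t‖ ≤ Real.exp ((Λ + 2) * T) * (‖u₀‖ + (‖u₁‖ + ‖b‖ * ‖u₀‖)) := by
  obtain ⟨ut, ux, hux, hux_cont, hut, h0, heq⟩ := h.exists_integrated
  have := norm_le_of_integrated_equation hΛ hb
    (sturmLiouvilleBoundedBelow_iff.1 (hq.add_nonneg ha)) hux hux_cont hut
    (D := ‖u₁‖ + ‖b‖ * ‖u₀‖)
    (fun t _ => (norm_add_le _ _).trans (by gcongr; exact norm_mulOp_apply_le _ _)) heq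
  rwa [h0] at this

/-- Stability of the solutions under perturbations of the coefficients and of the data. -/
theorem IsSolution.norm_sub_solution_le {T Λ M : ℝ} {a b q a' b' q' : Linfty} {u₀ u₁ u₀' u₁' : L2}
    {u u' : ℝ → L2} (h : IsSolution T a b q u₀ u₁ u) (h' : IsSolution T a' b' q' u₀' u₁' u')
    (hΛ : 0 ≤ Λ) (ha : 0 ≤ a) (hb : 0 ≤ b) (hq : SturmLiouvilleBoundedBelow q Λ)
    (hM : ∀ t ∈ Icc (0 : ℝ) T, ‖u' t‖ ≤ M) : ∀ t ∈ Icc (0 : ℝ) T,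
      ‖u t - u' t‖ ≤ Real.exp ((Λ + 2) * T) * (‖u₀ - u₀'‖ + (‖u₁ - u₁'‖ + ‖b‖ * ‖u₀ - u₀'‖
        + ‖b - b'‖ * ‖u₀'‖ + (‖q - q'‖ + ‖a - a'‖) * (M * T) + ‖b - b'‖ * M)) := by
  obtain ⟨ut, ux, hux, hux_cont, hut, h0, heq⟩ := h.exists_integrated
  obtain ⟨ut', ux', hux', hux_cont', hut', h0', heq'⟩ := h'.exists_integrated
  have hu_cont : ContinuousOn u (Icc 0 T) := fun t ht => (hut t ht).continuousWithinAt
  have hu_cont' : ContinuousOn u' (Icc 0 T) := fun t ht => (hut' t ht).continuousWithinAt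
  have hint : ∀ {v : ℝ → L2}, ContinuousOn v (Icc 0 T) → ∀ t ∈ Icc (0 : ℝ) T,
      IntervalIntegrable v volume 0 t := fun hv t ht =>
    (hv.mono (uIcc_subset_Icc ⟨le_rfl, ht.1.trans ht.2⟩ ht)).intervalIntegrable
  have hU' : ∀ t ∈ Icc (0 : ℝ) T, ‖∫ s in (0 : ℝ)..t, u' s‖ ≤ M * T := by
    intro t ht
    have hM0 : 0 ≤ M := (norm_nonneg _).trans (hM t ht)
    have := intervalIntegral.norm_integral_le_of_norm_le_const (a := 0) (b := t) (f := u') (C := M)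
      fun s hs => by
        rw [uIoc_of_le ht.1] at hs
        exact hM s ⟨hs.1.le, hs.2.trans ht.2⟩
    rw [sub_zero, abs_of_nonneg ht.1] at this
    exact this.trans (mul_le_mul_of_nonneg_left ht.2 hM0)
  have key := norm_le_of_integrated_equation (u := fun t => u t - u' t)
    (ut := fun t => ut t - ut' t) (ux := fun t => ux t - ux' t)
    -- The operator with the unprimed coefficients acts on the difference; all coefficient
    -- differences fall on `u'` or `u₀'`, using `b u₀ - b' u₀' = b (u₀ - u₀') + (b - b') u₀'`.
    (H := fun t => (u₁ - u₁') + mulOp b (u₀ - u₀') + mulOp (b - b') u₀'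
      - mulOp (q - q' + (a - a')) (∫ s in (0 : ℝ)..t, u' s) - mulOp (b - b') (u' t))
    (D := ‖u₁ - u₁'‖ + ‖b‖ * ‖u₀ - u₀'‖
        + ‖b - b'‖ * ‖u₀'‖ + (‖q - q'‖ + ‖a - a'‖) * (M * T) + ‖b - b'‖ * M)
    hΛ hb (sturmLiouvilleBoundedBelow_iff.1 (hq.add_nonneg ha))
    (fun t ht => (hux t ht).sub (hux' t ht)) (hux_cont.sub hux_cont')
    (fun t ht => (hut t ht).sub (hut' t ht)) (fun t ht => ?_) (fun t ht f g hfg => ?_)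
  · simpa only [h0, h0'] using key
  · refine (norm_sub_le _ _).trans (add_le_add ((norm_sub_le _ _).trans (add_le_add
      ((norm_add_le _ _).trans (add_le_add ((norm_add_le _ _).trans (add_le_add le_rfl ?_)) ?_)) ?_))
      ?_)
    · exact norm_mulOp_apply_le _ _
    · exact norm_mulOp_apply_le _ _
    · exact (norm_mulOp_apply_le _ _).trans (mul_le_mul (norm_add_le _ _) (hU' t ht)
        (norm_nonneg _) (by positivity))
    · exact (norm_mulOp_apply_le _ _).trans (mul_le_mul_of_nonneg_left (hM t ht) (norm_nonneg _))
  · have e := heq t ht f g hfg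
    have e' := heq' t ht f g hfg
    rw [intervalIntegral.integral_sub (hint hu_cont t ht) (hint hu_cont' t ht),
      intervalIntegral.integral_sub (hint hux_cont t ht) (hint hux_cont' t ht)]
    simp only [map_add, map_sub, add_apply, sub_apply, inner_add_right, inner_sub_right] at e e' ⊢
    linear_combination e - e'

/-! ### Moderate and negligible nets -/

section Nets

variable {X Y : Type*} [NormedAddCommGroup X] [NormedAddCommGroup Y]

theorem Moderate.mono {f : ℝ → X} {g : ℝ → Y} (hg : Moderate g)
    (h : ∀ ε ∈ Ioc (0 : ℝ) 1, ‖f ε‖ ≤ ‖g ε‖) : Moderate f := by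
  obtain ⟨N, C, hC⟩ := hg
  exact ⟨N, C, fun ε hε => (h ε hε).trans (hC ε hε)⟩

theorem Moderate.norm {f : ℝ → X} (hf : Moderate f) : Moderate (fun ε => ‖f ε‖) :=
  hf.mono fun ε _ => (norm_norm _).le

theorem Negligible.norm {f : ℝ → X} (hf : Negligible f) : Negligible (fun ε => ‖f ε‖) :=
  fun k => (hf k).imp fun _ hC ε hε => (norm_norm _).le.trans (hC ε hε)

theorem moderate_const (x : X) : Moderate (fun _ => x) :=
  ⟨0, ‖x‖, fun _ _ => by simp⟩

theorem Moderate.mul {f g : ℝ → ℝ} (hf : Moderate f) (hg : Moderate g) :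
    Moderate (fun ε => f ε * g ε) := by
  obtain ⟨N, C, hC⟩ := hf
  obtain ⟨M, D, hD⟩ := hg
  refine ⟨N + M, C * D, fun ε hε => ?_⟩
  calc ‖f ε * g ε‖ = ‖f ε‖ * ‖g ε‖ := norm_mul _ _
    _ ≤ (C * (ε ^ N)⁻¹) * (D * (ε ^ M)⁻¹) := mul_le_mul (hC ε hε) (hD ε hε) (norm_nonneg _)
        ((norm_nonneg _).trans (hC ε hε))
    _ = C * D * (ε ^ (N + M))⁻¹ := by rw [pow_add, mul_inv]; ring

theorem Moderate.add {f g : ℝ → X} (hf : Moderate f) (hg : Moderate g) :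
    Moderate (fun ε => f ε + g ε) := by
  obtain ⟨N, C, hC⟩ := hf
  obtain ⟨M, D, hD⟩ := hg
  refine ⟨N + M, |C| + |D|, fun ε hε => ?_⟩
  have h1 : (ε ^ N)⁻¹ ≤ (ε ^ (N + M))⁻¹ := inv_anti₀ (pow_pos hε.1 _)
    (pow_le_pow_of_le_one hε.1.le hε.2 (Nat.le_add_right _ _))
  have h2 : (ε ^ M)⁻¹ ≤ (ε ^ (N + M))⁻¹ := inv_anti₀ (pow_pos hε.1 _)
    (pow_le_pow_of_le_one hε.1.le hε.2 (Nat.le_add_left _ _))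
  have h3 : 0 ≤ (ε ^ N)⁻¹ := inv_nonneg.2 (pow_nonneg hε.1.le _)
  have h4 : 0 ≤ (ε ^ M)⁻¹ := inv_nonneg.2 (pow_nonneg hε.1.le _)
  calc ‖f ε + g ε‖ ≤ ‖f ε‖ + ‖g ε‖ := norm_add_le _ _
    _ ≤ C * (ε ^ N)⁻¹ + D * (ε ^ M)⁻¹ := add_le_add (hC ε hε) (hD ε hε)
    _ ≤ |C| * (ε ^ (N + M))⁻¹ + |D| * (ε ^ (N + M))⁻¹ := add_le_add
        (mul_le_mul (le_abs_self _) h1 h3 (abs_nonneg _))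
        (mul_le_mul (le_abs_self _) h2 h4 (abs_nonneg _))
    _ = _ := by ring

theorem Negligible.add {f g : ℝ → X} (hf : Negligible f) (hg : Negligible g) :
    Negligible (fun ε => f ε + g ε) := by
  intro k
  obtain ⟨C, hC⟩ := hf k
  obtain ⟨D, hD⟩ := hg k
  refine ⟨C + D, fun ε hε => (norm_add_le _ _).trans ?_⟩
  rw [add_mul]
  exact add_le_add (hC ε hε) (hD ε hε)

theorem Negligible.mul_moderate {f g : ℝ → ℝ} (hf : Negligible f) (hg : Moderate g) :
    Negligible (fun ε => f ε * g ε) := by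
  intro k
  obtain ⟨M, D, hD⟩ := hg
  -- The extra order `M` pays for the growth `ε^{-M}` of the moderate factor.
  obtain ⟨C, hC⟩ := hf (k + M)
  refine ⟨C * D, fun ε hε => ?_⟩
  have h0 : ε ^ M ≠ 0 := (pow_pos hε.1 _).ne'
  calc ‖f ε * g ε‖ = ‖f ε‖ * ‖g ε‖ := norm_mul _ _
    _ ≤ (C * ε ^ (k + M)) * (D * (ε ^ M)⁻¹) := mul_le_mul (hC ε hε) (hD ε hε) (norm_nonneg _)
        ((norm_nonneg _).trans (hC ε hε))
    _ = C * D * ε ^ k := by rw [pow_add]; field_simp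

theorem Moderate.mul_negligible {f g : ℝ → ℝ} (hf : Moderate f) (hg : Negligible g) :
    Negligible (fun ε => f ε * g ε) := by
  simpa only [mul_comm] using hg.mul_moderate hf

end Nets

theorem H2Moderate.moderate {f : ℝ → L2} (hf : H2Moderate f) : Moderate f := by
  obtain ⟨h, -, N, C, hC⟩ := hf
  exact ⟨N, C, fun ε hε => (le_add_of_nonneg_right (norm_nonneg _)).trans (hC ε hε)⟩

theorem H2Negligible.negligible {f : ℝ → L2} (hf : H2Negligible f) : Negligible f := by
  obtain ⟨h, -, hC⟩ := hf
  exact fun k => (hC k).imp fun C hC ε hε =>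
    (le_add_of_nonneg_right (norm_nonneg _)).trans (hC ε hε)

end

end VeryWeakWave

theorem mainTheorem8 (T : ℝ) (hT : 0 < T)
    -- two nets of coefficients
    (a a' b b' q q' : ℝ → Linfty)
    (ha_nonneg : ∀ ε ∈ Ioc (0 : ℝ) 1, 0 ≤ a ε) (ha'_nonneg : ∀ ε ∈ Ioc (0 : ℝ) 1, 0 ≤ a' ε)
    (hb_nonneg : ∀ ε ∈ Ioc (0 : ℝ) 1, 0 ≤ b ε) (hb'_nonneg : ∀ ε ∈ Ioc (0 : ℝ) 1, 0 ≤ b' ε)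
    (ha : Moderate a) (ha' : Moderate a') (hb : Moderate b) (hb' : Moderate b')
    (hq : Moderate q) (hq' : Moderate q')
    -- the operators `L_{q_ε}` are bounded below uniformly in `ε`
    (hq_below : ∃ Λ : ℝ, ∀ ε ∈ Ioc (0 : ℝ) 1, SturmLiouvilleBoundedBelow (q ε) Λ)
    -- two nets of initial data
    (u₀ u₀' u₁ u₁' : ℝ → L2)
    (hu₀ : H2Moderate u₀) (hu₀' : H2Moderate u₀') (hu₁ : Moderate u₁) (hu₁' : Moderate u₁')
    -- the two nets differ by negligible nets
    (haa' : Negligible (fun ε => a ε - a' ε)) (hbb' : Negligible (fun ε => b ε - b' ε))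
    (hqq' : Negligible (fun ε => q ε - q' ε))
    (hu₀u₀' : H2Negligible (fun ε => u₀ ε - u₀' ε))
    (hu₁u₁' : Negligible (fun ε => u₁ ε - u₁' ε))
    -- the solution nets of the regularised problems
    (u u' : ℝ → ℝ → L2)
    (hu : ∀ ε ∈ Ioc (0 : ℝ) 1, IsSolution T (a ε) (b ε) (q ε) (u₀ ε) (u₁ ε) (u ε))
    (hu' : ∀ ε ∈ Ioc (0 : ℝ) 1, IsSolution T (a' ε) (b' ε) (q' ε) (u₀' ε) (u₁' ε) (u' ε)) :
    L2NegligibleOn T (fun ε t => u ε t - u' ε t) := by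
  obtain ⟨Λ₀, hΛ₀⟩ := hq_below
  -- Order `0` of negligibility is a bound on `‖q_ε - q'_ε‖` uniform in `ε`.
  obtain ⟨C₀, hC₀⟩ := hqq' 0
  -- The energy estimate needs a nonnegative constant; enlarging it only weakens the lower bound.
  set Λ := max Λ₀ 0
  set Λ' := max (Λ₀ + C₀) 0
  have hq1 : ∀ ε ∈ Ioc (0 : ℝ) 1, SturmLiouvilleBoundedBelow (q ε) Λ := fun ε hε =>
    (hΛ₀ ε hε).mono (le_max_left _ _)
  have hq2 : ∀ ε ∈ Ioc (0 : ℝ) 1, SturmLiouvilleBoundedBelow (q' ε) Λ' := fun ε hε =>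
    ((hΛ₀ ε hε).of_norm_sub_le (by simpa using hC₀ ε hε)).mono (le_max_left _ _)
  set M : ℝ → ℝ := fun ε =>
    Real.exp ((Λ' + 2) * T) * (‖u₀' ε‖ + (‖u₁' ε‖ + ‖b' ε‖ * ‖u₀' ε‖))
  -- The exponential factor does not depend on `ε`, because the lower bound is uniform.
  have hM : Moderate M := (moderate_const _).mul (hu₀'.moderate.norm.add
    (hu₁'.norm.add (hb'.norm.mul hu₀'.moderate.norm)))
  have hu'M : ∀ ε ∈ Ioc (0 : ℝ) 1, ∀ t ∈ Icc (0 : ℝ) T, ‖u' ε t‖ ≤ M ε := fun ε hε =>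
    (hu' ε hε).norm_le (le_max_right _ _) (ha'_nonneg ε hε) (hb'_nonneg ε hε) (hq2 ε hε)
  have hd := hu₀u₀'.negligible.norm
  have hneg := (moderate_const (Real.exp ((Λ + 2) * T))).mul_negligible
    (hd.add ((((hu₁u₁'.norm.add (hb.norm.mul_negligible hd)).add
      (hbb'.norm.mul_moderate hu₀'.moderate.norm)).add
      ((hqq'.norm.add haa'.norm).mul_moderate (hM.mul (moderate_const T)))).add
      (hbb'.norm.mul_moderate hM)))
  intro k
  obtain ⟨C, hC⟩ := hneg k
  exact ⟨C, fun ε hε t ht => ((hu ε hε).norm_sub_solution_le (hu' ε hε) (le_max_right _ _)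
    (ha_nonneg ε hε) (hb_nonneg ε hε) (hq1 ε hε) (hu'M ε hε) t ht).trans
      ((le_abs_self _).trans (hC ε hε))⟩
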